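/- Let $k$ be a field and let $A=A_0\oplus A_1\oplus\cdots$ be a connected graded associative unital $k$-algebra, i.e. $A_0=k$ and every $A_n$ is finite-dimensional. For a graded vector space $V$ with finite-dimensional components write $V(t)=\sum_{n\ge 0}\dim(V_n)\,t^n$ and let $r(V)\in[0,\infty]$ be the radius of convergence of $V(t)$. Assume that $r(A)>0$, and that $A$ is finitely generated or, more generally, that $A(t)\to\infty$ as $t\to r(A)^-$. Let $S\subset A$ be a non-empty set of homogeneous elements of positive degree which minimally generates a two-sided ideal $I$ (that is, $S$ generates $I$ and no proper subset of $S$ does). Put $B=A/I$ with the induced grading, $S(t)=\sum_{s\in S}t^{\deg s}$, and $C=B*k\langle S\rangle$, the free product of $B$ and the free associative algebra on $S$, graded so that each free generator $s\in S$ has the degree it has in $A$. The set $S$ is called strongly free in $A$ if $C(t)=A(t)$. Values of series with nonnegative coefficients at points of $[0,\infty]$ are understood in $[0,\infty]$: the value at a finite point is the sum, which is $\infty$ if the series diverges, and the value at $\infty$ is the limit as $t\to\infty$. Then $$B(r(A))\,S(r(A))\ \ge\ 1,$$ and the following conditions are equivalent: (i) $B(r(A))\,S(r(A))=1$; (ii)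 $r(A)=r(C)$; (iii) $S$ is strongly free in $A$. In particular, if $S$ consists of $t$ elements, all of degree $l$, then $$t\ \ge\ B(r(A))^{-1}\,r(A)^{-l}$$ (with $\infty^{-1}=0$), and equality holds if and only if $S$ is strongly free in $A$. -/

import Mathlib

open scoped ENNReal

universe u v w

noncomputable section

namespace GradedGrowth

/-! ### Hilbert series, their values on `[0, ∞]` and radii of convergence -/

section Hilbert

variable {k : Type u} [CommSemiring k] {V : Type v} [AddCommMonoid V] [Module k V]

/-- The Hilbert series `∑ dim V_n tⁿ` of a family of subspaces (homogeneous components). -/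
def hilbertSeries (𝒱 : ℕ → Submodule k V) : PowerSeries ℕ :=
  PowerSeries.mk fun n => Module.finrank k (𝒱 n)

/-- The value in `[0, ∞]` at `x ∈ [0, ∞]` of a power series with nonnegative coefficients.
It is `∞` where the series diverges.  By the conventions `∞ ^ 0 = 1` and `0 * ∞ = 0` of `ℝ≥0∞`,
the value at `∞` is the limit for `x → ∞`. -/
def evalSeries (f : PowerSeries ℕ) (x : ℝ≥0∞) : ℝ≥0∞ :=
  ∑' n : ℕ, ((PowerSeries.coeff n f : ℕ) : ℝ≥0∞) * x ^ n

/-- The radius of convergence, in `[0, ∞]`, of a power series. -/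
def seriesRadius (f : PowerSeries ℕ) : ℝ≥0∞ :=
  (FormalMultilinearSeries.ofScalars ℝ
    (fun n : ℕ => ((PowerSeries.coeff n f : ℕ) : ℝ))).radius

/-- The value `V(x)` in `[0, ∞]` of the Hilbert series of `V` at `x ∈ [0, ∞]`. -/
def evalHilbert (𝒱 : ℕ → Submodule k V) (x : ℝ≥0∞) : ℝ≥0∞ :=
  evalSeries (hilbertSeries 𝒱) x

/-- `r(V)`: the radius of convergence of the Hilbert series. -/
def radius (𝒱 : ℕ → Submodule k V) : ℝ≥0∞ :=
  seriesRadius (hilbertSeries 𝒱)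

end Hilbert

/-- A connected graded algebra: the components are finite-dimensional and the zero component
is the ground field (embedded by a nonzero unit). -/
structure IsConnectedGraded {k : Type u} [Field k] {A : Type v} [Ring A] [Algebra k A]
    (𝒜 : ℕ → Submodule k A) [GradedAlgebra 𝒜] : Prop where
  nontrivial : Nontrivial A
  zero_eq : 𝒜 0 = 1
  finite : ∀ n, Module.Finite k (𝒜 n)

/-! ### The free product of two graded algebras -/

section FreeProduct

variable (k : Type u) [CommRing k]

/-- The two factors, lifted to a common universe, as a family indexed by `Bool`. -/
def Factor (B : Type v) (F : Type w) : Bool → Type (max v w)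
  | false => ULift.{w} B
  | true => ULift.{v} F

instance Factor.instRing (B : Type v) (F : Type w) [Ring B] [Ring F] :
    ∀ i, Ring (Factor B F i)
  | false => inferInstanceAs (Ring (ULift.{w} B))
  | true => inferInstanceAs (Ring (ULift.{v} F))

instance Factor.instAlgebra (B : Type v) (F : Type w) [Ring B] [Ring F]
    [Algebra k B] [Algebra k F] : ∀ i, Algebra k (Factor B F i)
  | false => inferInstanceAs (Algebra k (ULift.{w} B))
  | true => inferInstanceAs (Algebra k (ULift.{v} F))

variable (B : Type v) (F : Type w) [Ring B] [Ring F] [Algebra k B] [Algebra k F]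

/-- The free product `B * F` (coproduct of unital associative `k`-algebras). -/
abbrev FreeProd : Type (max u v w) :=
  LinearAlgebra.FreeProduct k (Factor B F)

/-- The canonical map `B → B * F`. -/
def inl : B →ₐ[k] FreeProd k B F :=
  (LinearAlgebra.FreeProduct.ι k (Factor B F) false).comp
    ((ULift.algEquiv (R := k) (A := B)).symm : B →ₐ[k] ULift.{w} B)

/-- The canonical map `F → B * F`. -/
def inr : F →ₐ[k] FreeProd k B F :=
  (LinearAlgebra.FreeProduct.ι k (Factor B F) true).comp
    ((ULift.algEquiv (R := k) (A := F)).symm : F →ₐ[k] ULift.{v} F)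

variable {k B F}

/-- `IsHomogProd ℬ ℱ n x`: the element `x` of `B * F` is a product of homogeneous elements of
`B` and of `F` whose degrees add up to `n`. -/
inductive IsHomogProd (ℬ : ℕ → Submodule k B) (ℱ : ℕ → Submodule k F) :
    ℕ → FreeProd k B F → Prop
  | one : IsHomogProd ℬ ℱ 0 1
  | inl_mul {m n : ℕ} {b : B} {x : FreeProd k B F} :
      b ∈ ℬ m → IsHomogProd ℬ ℱ n x → IsHomogProd ℬ ℱ (m + n) (inl k B F b * x)
  | inr_mul {m n : ℕ} {y : F} {x : FreeProd k B F} :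
      y ∈ ℱ m → IsHomogProd ℬ ℱ n x → IsHomogProd ℬ ℱ (m + n) (inr k B F y * x)

/-- The grading of `B * F` induced by gradings of the factors. -/
def freeProdGrading (ℬ : ℕ → Submodule k B) (ℱ : ℕ → Submodule k F) (n : ℕ) :
    Submodule k (FreeProd k B F) :=
  Submodule.span k {x | IsHomogProd ℬ ℱ n x}

end FreeProduct

/-- The grading of the free algebra `k⟨X⟩` in which the generator `x` has degree `deg x`. -/
def freeAlgebraGrading (k : Type u) [CommRing k] {X : Type v} (deg : X → ℕ) (n : ℕ) :
    Submodule k (FreeAlgebra k X) :=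
  Submodule.span k
    {x | ∃ word : List X, (word.map deg).sum = n ∧ (word.map (FreeAlgebra.ι k)).prod = x}

/-! ### Relations in a graded algebra -/

section Relations

variable {k : Type u} [Field k] {A : Type v} [Ring A] [Algebra k A]

/-- `S` is a minimal set of generators of the two-sided ideal that it generates. -/
def MinimallyGenerates (S : Set A) : Prop :=
  ∀ T : Set A, T ⊂ S → TwoSidedIdeal.span T ≠ TwoSidedIdeal.span S

/-- The quotient algebra `B = A / I`, where `I` is the two-sided ideal generated by `S`. -/
abbrev QuotAlg (S : Set A) : Type v := (TwoSidedIdeal.span S).ringCon.Quotient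

/-- The grading of `B = A / I` by the images of the components of `A`. -/
def quotGrading (𝒜 : ℕ → Submodule k A) (S : Set A) (n : ℕ) : Submodule k (QuotAlg S) :=
  (𝒜 n).map (RingCon.mkₐ k (TwoSidedIdeal.span S).ringCon).toLinearMap

/-- The grading of `C = B * k⟨S⟩`, where the free generator `s` has degree `deg s`. -/
def extGrading (𝒜 : ℕ → Submodule k A) (S : Set A) (deg : S → ℕ) :
    ℕ → Submodule k (FreeProd k (QuotAlg S) (FreeAlgebra k S)) :=
  freeProdGrading (quotGrading 𝒜 S) (freeAlgebraGrading k deg)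

/-- The value at `x ∈ [0, ∞]` of the generating function `S(t) = ∑_{s ∈ S} t ^ deg s`. -/
def evalGen {S : Set A} (deg : S → ℕ) (x : ℝ≥0∞) : ℝ≥0∞ :=
  ∑' s : S, x ^ deg s

/-- `S` is strongly free (inert) in `A`: the Hilbert series of `B * k⟨S⟩` and `A` coincide. -/
def StronglyFree (𝒜 : ℕ → Submodule k A) (S : Set A) (deg : S → ℕ) : Prop :=
  hilbertSeries (extGrading 𝒜 S deg) = hilbertSeries 𝒜

end Relations

end GradedGrowth

end

open GradedGrowth

/-!
Choose a homogeneous basis `β` of `B = A / I` and homogeneous lifts `σ i ∈ A` of its elements, and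
consider the words `σ i₀ * (s₁ * σ i₁) * ⋯ * (sₙ * σ iₙ)` with `sⱼ ∈ S`.  Their generating function,
evaluated at any `x ∈ [0, ∞]`, is `B(x) ∑ₙ (B(x) S(x))ⁿ`.

* Words span `A` (`span_words_eq_top`), so this sum bounds `A(x)` from above.  As `A(r(A)) = ∞`, the
  geometric series diverges at `r(A)`, that is, `B(r(A)) S(r(A)) ≥ 1`.
* The corresponding words in `C = B * k⟨S⟩` form a homogeneous basis (`linearIndependent_words`,
  `freeProdGrading_eq_span`): linear independence is seen on the module `List (S × ι) →₀ B`, on which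
  words act freely.  So `C(x) = B(x) ∑ₙ (B(x) S(x))ⁿ`, provided that there are only finitely many
  words of each degree; this holds because minimality makes `S` linearly independent.  If
  `r(C) = r(A)`, then `B(x) S(x) < 1` for `x < r(A)`, and `B(r(A)) S(r(A)) ≤ 1` in the limit.
* Let `B(r(A)) S(r(A)) = 1`.  If the words were linearly dependent in `A`, then a word `w` of minimal
  length in a nontrivial relation would be a combination of other words of the same length and longer
  ones.  Hence a product `v = s * w` of letters `s * σ i` could be replaced wherever it occurs, and
  `A` would be spanned by words without an aligned block `v` (`exists_blockAvoiding_span`).  The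
  letters have total weight `B(r(A)) S(r(A)) = 1`, so the blocks different from `v` have total weight
  less than `1`, and the generating function of those words converges at `r(A)`, contrary to
  `A(r(A)) = ∞`.  So the words form a basis of `A`, as they do in `C`, and `A(t) = C(t)`.

For finitely generated `A`, the divergence of `A(t)` at `r(A)` follows by splitting words in the
generators: if `d` bounds the degrees of generators, then
`dim A_N ≤ ∑_{m - d < j ≤ m} dim A_j · dim A_{N - j}`, and if `dim A_n · r(A)ⁿ` tended to `0`, this
would force geometric decay of these terms, that is, a larger radius of convergence
(`lt_seriesRadius_of_convolution_le`).
-/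

namespace GradedGrowth

/-! ### Sums over words, and values of series at the radius of convergence -/

section Words

variable {U : Type*}

theorem tsum_list_length_eq (f : U → ℝ≥0∞) (n : ℕ) :
    ∑' l : {l : List U // l.length = n}, (l.1.map f).prod = (∑' u, f u) ^ n := by
  induction n with
  | zero =>
    rw [tsum_eq_single ⟨[], rfl⟩]
    · simp
    · rintro ⟨l, hl⟩ h
      exact absurd (Subtype.ext (List.length_eq_zero_iff.mp hl)) h
  | succ n ih =>
    let e : U × {l : List U // l.length = n} ≃ {l : List U // l.length = n + 1} :=
      { toFun := fun p => ⟨p.1 :: p.2.1, by simp [p.2.2]⟩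
        invFun := fun l => ⟨l.1.head (by rintro h; simpa [h] using l.2),
          ⟨l.1.tail, by simp [l.2]⟩⟩
        left_inv := fun p => by simp
        right_inv := fun l => by simp }
    rw [← e.tsum_eq, ENNReal.tsum_prod', pow_succ', ← ENNReal.tsum_mul_right]
    refine tsum_congr fun u => ?_
    rw [← ih, ← ENNReal.tsum_mul_left]
    exact tsum_congr fun l => by simp [e]

theorem tsum_list (f : U → ℝ≥0∞) :
    ∑' l : List U, (l.map f).prod = ∑' n : ℕ, (∑' u, f u) ^ n := by
  rw [← (Equiv.sigmaFiberEquiv (List.length : List U → ℕ)).tsum_eq, ENNReal.tsum_sigma']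
  exact tsum_congr fun n => tsum_list_length_eq f n

theorem pow_sum_map (x : ℝ≥0∞) (d : U → ℕ) (l : List U) :
    x ^ (l.map d).sum = (l.map fun u => x ^ d u).prod := by
  induction l with
  | nil => simp
  | cons a l ih => simp [pow_add, ih]

/-- Removing one word `v` from the words of length `n` lowers their generating function by the
weight of `v`. -/
theorem tsum_list_length_eq_ne (f : U → ℝ≥0∞) (v : List U) :
    ∑' l : {l : {l : List U // l.length = v.length} // l ≠ ⟨v, rfl⟩}, (l.1.1.map f).prod
      + (v.map f).prod = (∑' u, f u) ^ v.length := by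
  classical
  rw [← tsum_list_length_eq, ENNReal.tsum_eq_add_tsum_ite
    (f := fun l : {l : List U // l.length = v.length} => (l.1.map f).prod) ⟨v, rfl⟩, add_comm]
  congr 1
  refine (tsum_subtype {l : {l : List U // l.length = v.length} | l ≠ ⟨v, rfl⟩}
    (fun l => (l.1.map f).prod)).trans ?_
  refine tsum_congr fun l => ?_
  by_cases h : l = ⟨v, rfl⟩ <;> simp [Set.indicator, h]

/-- Only finitely many words have a given degree, if that holds for letters and all letters have
positive degree. -/
theorem finite_lists_of_degree {d : U → ℕ} (hpos : ∀ u, 0 < d u)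
    (hfin : ∀ n, {u | d u = n}.Finite) (n : ℕ) : {l : List U | (l.map d).sum = n}.Finite := by
  have hF : {u | d u ≤ n}.Finite := by
    have : {u | d u ≤ n} = ⋃ m ∈ Set.Iic n, {u | d u = m} := by ext; simp
    rw [this]
    exact (Set.finite_Iic n).biUnion fun m _ => hfin m
  have : Finite {u | d u ≤ n} := hF
  refine ((List.finite_length_le {u | d u ≤ n} n).image (List.map Subtype.val)).subset ?_
  rintro l (rfl : _ = n)
  have hle : ∀ u ∈ l, d u ≤ (l.map d).sum := fun u hu =>
    List.single_le_sum (by simp) _ (List.mem_map_of_mem hu)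
  have hlen : ∀ l : List U, l.length ≤ (l.map d).sum := fun l => by
    induction l with
    | nil => simp
    | cons a l ih => have := hpos a; simp; lia
  exact ⟨l.pmap Subtype.mk hle, by
    rw [Set.mem_ofPred_eq, List.length_pmap]; exact hlen l, by simp [List.map_pmap]⟩

end Words

section Series

theorem evalSeries_eq_coe (f : PowerSeries ℕ) (x : NNReal) :
    evalSeries f x =
      ∑' n : ℕ, ((((PowerSeries.coeff n f : ℕ) : NNReal) * x ^ n : NNReal) : ℝ≥0∞) := by
  simp [evalSeries]

theorem evalSeries_ne_top_of_lt {f : PowerSeries ℕ} {x : NNReal}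
    (h : (x : ℝ≥0∞) < seriesRadius f) : evalSeries f x ≠ ∞ := by
  rw [evalSeries_eq_coe, ENNReal.tsum_coe_ne_top_iff_summable_coe]
  have := FormalMultilinearSeries.summable_norm_mul_pow _ h
  simp only [FormalMultilinearSeries.ofScalars_norm, Real.norm_natCast] at this
  exact_mod_cast this

theorem le_seriesRadius_of_bound {f : PowerSeries ℕ} {x : NNReal} (C : ℝ)
    (h : ∀ n, ((PowerSeries.coeff n f : ℕ) : ℝ) * (x : ℝ) ^ n ≤ C) :
    (x : ℝ≥0∞) ≤ seriesRadius f := by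
  refine FormalMultilinearSeries.le_radius_of_bound _ C fun n => ?_
  simpa [FormalMultilinearSeries.ofScalars_norm] using h n

/-- A power series with nonnegative coefficients takes at `r` a value at most the supremum of its
values to the left of `r`; stated for a sum of monomials. -/
theorem tsum_pow_le_of_forall_lt {P : Type*} (d : P → ℕ) {r C : ℝ≥0∞} (hr : 0 < r)
    (h : ∀ x : NNReal, (x : ℝ≥0∞) < r → ∑' p, (x : ℝ≥0∞) ^ d p ≤ C) :
    ∑' p, r ^ d p ≤ C := by
  refine ENNReal.summable.tsum_le_of_sum_le fun s => ?_
  have hne : (nhdsWithin r (Set.Iio r)).NeBot := nhdsLT_neBot_of_exists_lt ⟨0, hr⟩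
  have ht : Filter.Tendsto (fun x : ℝ≥0∞ => ∑ p ∈ s, x ^ d p) (nhdsWithin r (Set.Iio r))
      (nhds (∑ p ∈ s, r ^ d p)) :=
    (tendsto_finsetSum s fun p _ => (ENNReal.continuous_pow (d p)).tendsto r).mono_left
      nhdsWithin_le_nhds
  refine le_of_tendsto ht ?_
  filter_upwards [self_mem_nhdsWithin] with x hx
  lift x to NNReal using (lt_top_of_lt hx).ne
  exact (ENNReal.sum_le_tsum s).trans (h x hx)

end Series

/-! ### Hilbert series from homogeneous spanning families and bases -/

section Counting

variable {k : Type*} [Field k] {V : Type*} [AddCommGroup V] [Module k V] {Ω : Type*}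

theorem tsum_pow_eq_tsum_card (d : Ω → ℕ) (x : ℝ≥0∞) :
    ∑' ω, x ^ d ω = ∑' n : ℕ, (ENat.card {ω // d ω = n} : ℝ≥0∞) * x ^ n := by
  rw [← (Equiv.sigmaFiberEquiv d).tsum_eq, ENNReal.tsum_sigma']
  refine tsum_congr fun n => ?_
  rw [← ENNReal.tsum_const]
  exact tsum_congr fun ω => by simp [ω.2]

/-- If the `w ω` with `d ω = n` span a space containing the component `𝒱 n`, for all `n`, then the
Hilbert series is at most the generating function of `d`, whose fibres may be infinite. -/
theorem evalHilbert_le_tsum {𝒱 : ℕ → Submodule k V} (w : Ω → V) (d : Ω → ℕ)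
    (h : ∀ n, 𝒱 n ≤ Submodule.span k (w '' {ω | d ω = n})) (x : ℝ≥0∞) :
    evalHilbert 𝒱 x ≤ ∑' ω, x ^ d ω := by
  rw [tsum_pow_eq_tsum_card, evalHilbert, evalSeries]
  refine ENNReal.tsum_le_tsum fun n => mul_le_mul_left ?_ _
  rw [hilbertSeries, PowerSeries.coeff_mk]
  rcases finite_or_infinite {ω // d ω = n} with hf | hi
  · have hs : {ω | d ω = n}.Finite := hf
    have hfin : (w '' {ω | d ω = n}).Finite := hs.image w
    have := hfin.fintype
    have : Module.Finite k (Submodule.span k (w '' {ω | d ω = n})) := .span_of_finite k hfin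
    have h1 := (Submodule.finrank_mono (h n)).trans (finrank_span_le_card (R := k) _)
    rw [ENat.card_eq_coe_natCard]
    have h2 : Nat.card (w '' {ω | d ω = n}) ≤ Nat.card {ω // d ω = n} :=
      Nat.card_image_le hs
    rw [Set.toFinset_card, ← Nat.card_eq_fintype_card] at h1
    exact_mod_cast h1.trans h2
  · rw [ENat.card_eq_top_of_infinite]
    simp

/-- The fibres of `d` may be infinite: then both sides have the coefficient `0`. -/
theorem hilbertSeries_eq_card {𝒱 : ℕ → Submodule k V} {w : Ω → V} (d : Ω → ℕ)
    (hw : LinearIndependent k w)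
    (h : ∀ n, 𝒱 n = Submodule.span k (w '' {ω | d ω = n})) :
    hilbertSeries 𝒱 = PowerSeries.mk fun n => Nat.card {ω // d ω = n} := by
  ext n
  rw [hilbertSeries, PowerSeries.coeff_mk, PowerSeries.coeff_mk, h n, Module.finrank]
  have hcard : Nat.card (w '' {ω | d ω = n}) = Nat.card {ω // d ω = n} :=
    Nat.card_image_of_injective hw.injective {ω | d ω = n}
  rw [← hcard]
  have : LinearIndepOn k id (w '' {ω | d ω = n}) := (hw.linearIndepOn _).id_image
  rw [rank_span_set this]
  rfl

theorem evalHilbert_eq_tsum {𝒱 : ℕ → Submodule k V} {w : Ω → V} (d : Ω → ℕ)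
    (hw : LinearIndependent k w)
    (h : ∀ n, 𝒱 n = Submodule.span k (w '' {ω | d ω = n})) (hfin : ∀ n, {ω | d ω = n}.Finite)
    (x : ℝ≥0∞) :
    evalHilbert 𝒱 x = ∑' ω, x ^ d ω := by
  rw [tsum_pow_eq_tsum_card, evalHilbert, hilbertSeries_eq_card d hw h, evalSeries]
  refine tsum_congr fun n => ?_
  have : Finite {ω // d ω = n} := hfin n
  rw [PowerSeries.coeff_mk, ENat.card_eq_coe_natCard]
  simp

end Counting

/-! ### Words in an algebra -/

section Words

variable {k : Type*} [Field k] {R : Type*} [Ring R] [Algebra k R] {U ι X : Type*}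

theorem span_range_pow (f : U → R) (n : ℕ) :
    Submodule.span k (Set.range f) ^ n =
      Submodule.span k ((fun l : List U => (l.map f).prod) '' {l | l.length = n}) := by
  induction n with
  | zero =>
    rw [pow_zero, Submodule.one_eq_span]
    congr 1
    ext x
    simp [List.length_eq_zero_iff]
  | succ n ih =>
    rw [pow_succ', ih, Submodule.span_mul_span]
    congr 1
    ext x
    simp only [Set.mem_mul, Set.mem_range, Set.mem_image, Set.mem_ofPred_eq]
    constructor
    · rintro ⟨_, ⟨u, rfl⟩, _, ⟨l, hl, rfl⟩, rfl⟩
      exact ⟨u :: l, by simp [hl], by simp⟩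
    · rintro ⟨_ | ⟨u, l⟩, hl, rfl⟩
      · simp at hl
      · exact ⟨f u, ⟨u, rfl⟩, _, ⟨l, by simpa using hl, rfl⟩, by simp⟩

variable (k) in
/-- The span of the products of at least `n` factors of the form `f u`. -/
def longSpan (f : U → R) (n : ℕ) : Submodule k R :=
  Submodule.span k ((fun l : List U => (l.map f).prod) '' {l | n ≤ l.length})

theorem longSpan_anti (f : U → R) {m n : ℕ} (h : m ≤ n) : longSpan k f n ≤ longSpan k f m :=
  Submodule.span_mono (Set.image_mono fun _ hl => h.trans hl)

theorem pow_le_longSpan (f : U → R) (n : ℕ) :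
    Submodule.span k (Set.range f) ^ n ≤ longSpan k f n := by
  rw [span_range_pow]
  exact Submodule.span_mono (Set.image_mono fun _ hl => le_of_eq (Eq.symm hl))

theorem longSpan_mul_le (f : U → R) (m n : ℕ) :
    longSpan k f m * longSpan k f n ≤ longSpan k f (m + n) := by
  rw [longSpan, longSpan, Submodule.span_mul_span, Submodule.span_le]
  rintro _ ⟨_, ⟨l, hl, rfl⟩, _, ⟨l', hl', rfl⟩, rfl⟩
  refine Submodule.subset_span ⟨l ++ l', ?_, by simp⟩
  rw [Set.mem_ofPred_eq] at *
  rw [List.length_append]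
  exact add_le_add hl hl'

theorem longSpan_le (f : U → R) (n : ℕ) :
    longSpan k f n ≤ Submodule.span k (Set.range f) ^ n ⊔ longSpan k f (n + 1) := by
  rw [longSpan, Submodule.span_le]
  rintro _ ⟨l, hl, rfl⟩
  rcases (show n ≤ l.length from hl).eq_or_lt with h | h
  · refine Submodule.mem_sup_left ?_
    rw [span_range_pow]
    exact Submodule.subset_span ⟨l, h.symm, rfl⟩
  · exact Submodule.mem_sup_right (Submodule.subset_span ⟨l, h, rfl⟩)

/-- Words of length `v.length` other than `v`. -/
abbrev OtherBlock (v : List U) : Type _ :=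
  {l : {l : List U // l.length = v.length} // l ≠ ⟨v, rfl⟩}

/-- Words that, cut into consecutive blocks of length `v.length`, have no block equal to `v`:
a list of blocks, and a remainder shorter than `v`. -/
abbrev BlockAvoiding (v : List U) : Type _ :=
  List (OtherBlock v) × Σ q : Fin v.length, {l : List U // l.length = q}

/-- The word given by its blocks. -/
def BlockAvoiding.toList {v : List U} (b : BlockAvoiding v) : List U :=
  (b.1.map fun l => l.1.1).flatten ++ b.2.2.1

variable {f : U → R} {v : List U}

theorem pow_length_le
    (hv : (v.map f).prod ∈
      Submodule.span k (Set.range fun l : OtherBlock v => (l.1.1.map f).prod) ⊔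
        longSpan k f (v.length + 1)) :
    Submodule.span k (Set.range f) ^ v.length ≤
      Submodule.span k (Set.range fun l : OtherBlock v => (l.1.1.map f).prod) ⊔
        longSpan k f (v.length + 1) := by
  rw [span_range_pow, Submodule.span_le]
  rintro _ ⟨l, hl, rfl⟩
  by_cases h : l = v
  · subst h; exact hv
  · exact Submodule.mem_sup_left (Submodule.subset_span
      ⟨⟨⟨l, hl⟩, fun h' => h (congrArg Subtype.val h')⟩, rfl⟩)

/-- In a product of `m * v.length` factors every block of length `v.length` can be rewritten without
`v`, up to longer products. -/
theorem pow_length_mul_le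
    (hv : (v.map f).prod ∈
      Submodule.span k (Set.range fun l : OtherBlock v => (l.1.1.map f).prod) ⊔
        longSpan k f (v.length + 1)) (m : ℕ) :
    Submodule.span k (Set.range f) ^ (m * v.length) ≤
      Submodule.span k (Set.range fun l : OtherBlock v => (l.1.1.map f).prod) ^ m ⊔
        longSpan k f (m * v.length + 1) := by
  set Y := Submodule.span k (Set.range fun l : OtherBlock v => (l.1.1.map f).prod) with hY
  have hYX : Y ≤ longSpan k f v.length := by
    rw [hY, Submodule.span_le]
    rintro _ ⟨l, rfl⟩
    exact Submodule.subset_span ⟨l.1.1, l.1.2.ge, rfl⟩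
  have hYm : ∀ m, Y ^ m ≤ longSpan k f (m * v.length) := fun m => by
    induction m with
    | zero => simpa using pow_le_longSpan (k := k) f 0
    | succ m ih =>
      rw [pow_succ, Nat.succ_mul]
      exact (mul_le_mul' ih hYX).trans (longSpan_mul_le f _ _)
  induction m with
  | zero => simp
  | succ m ih =>
    rw [Nat.succ_mul, pow_add]
    refine (mul_le_mul' ih (pow_length_le hv)).trans ?_
    rw [Submodule.sup_mul, Submodule.mul_sup, Submodule.mul_sup, pow_succ]
    have h1 := (mul_le_mul' (hYm m) (le_refl (longSpan k f (v.length + 1)))).trans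
      (longSpan_mul_le f _ _)
    have h2 := (mul_le_mul' (le_refl (longSpan k f (m * v.length + 1))) hYX).trans
      (longSpan_mul_le f _ _)
    have h3 := longSpan_mul_le (k := k) f (m * v.length + 1) (v.length + 1)
    refine sup_le (sup_le le_sup_left ?_) (sup_le ?_ ?_) <;> refine le_sup_of_le_right ?_
    · exact h1.trans (longSpan_anti f (by lia))
    · exact h2.trans (longSpan_anti f (by lia))
    · exact h3.trans (longSpan_anti f (by lia))

/-- If one word `v` can be rewritten by other words of the same length and longer words, then all
words can be rewritten by words without aligned block `v`, up to longer words. -/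
theorem longSpan_le_blockAvoiding (hpos : 0 < v.length)
    (hv : (v.map f).prod ∈
      Submodule.span k (Set.range fun l : OtherBlock v => (l.1.1.map f).prod) ⊔
        longSpan k f (v.length + 1)) (n : ℕ) :
    longSpan k f 0 ≤
      Submodule.span k (Set.range fun b : BlockAvoiding v => (b.toList.map f).prod) ⊔
        longSpan k f n := by
  induction n with
  | zero => exact le_sup_right
  | succ n ih =>
    refine ih.trans (sup_le le_sup_left ((longSpan_le f n).trans (sup_le ?_ le_sup_right)))
    obtain ⟨m, q, hq, rfl⟩ : ∃ m q, q < v.length ∧ n = m * v.length + q :=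
      ⟨n / v.length, n % v.length, Nat.mod_lt _ hpos, (Nat.div_add_mod' _ _).symm⟩
    rw [pow_add]
    refine (mul_le_mul' (pow_length_mul_le hv m) le_rfl).trans ?_
    rw [Submodule.sup_mul]
    refine sup_le_sup ?_ ?_
    · rw [span_range_pow, span_range_pow, Submodule.span_mul_span, Submodule.span_le]
      rintro _ ⟨_, ⟨l, hl, rfl⟩, _, ⟨l', hl', rfl⟩, rfl⟩
      refine Submodule.subset_span ⟨⟨l, ⟨⟨q, hq⟩, ⟨l', hl'⟩⟩⟩, ?_⟩
      simp [BlockAvoiding.toList, List.map_flatten, List.prod_flatten, Function.comp_def]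
    · exact (mul_le_mul' le_rfl (pow_le_longSpan f q)).trans
        ((longSpan_mul_le f _ _).trans (longSpan_anti f (by lia)))

/-- If the letters have total weight `1`, then the blocks other than `v` have total weight
`1 - x ^ deg v`, and each of the `v.length` possible lengths of the remainder contributes `1`. -/
theorem tsum_blockAvoiding (d : U → ℕ) (v : List U) (x : ℝ≥0∞) (hx : ∑' u, x ^ d u = 1) :
    ∑' b : BlockAvoiding v, x ^ (b.toList.map d).sum =
      (∑' m : ℕ, (1 - x ^ (v.map d).sum) ^ m) * v.length := by
  have hb : ∑' l : OtherBlock v, x ^ (l.1.1.map d).sum = 1 - x ^ (v.map d).sum := by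
    have h := tsum_list_length_eq_ne (fun u => x ^ d u) v
    simp only [← pow_sum_map, hx, one_pow] at h
    refine ENNReal.eq_sub_of_add_eq (fun htop => ?_) h
    simp [htop] at h
  rw [ENNReal.tsum_prod', ← hb, ← tsum_list, ← ENNReal.tsum_mul_right]
  refine tsum_congr fun l => ?_
  have hsplit : ∀ c : Σ q : Fin v.length, {l : List U // l.length = q},
      x ^ ((BlockAvoiding.toList (l, c)).map d).sum =
        (l.map fun l => x ^ (l.1.1.map d).sum).prod * x ^ (c.2.1.map d).sum := fun c => by
    rw [BlockAvoiding.toList, List.map_append, List.sum_append, pow_add, ← pow_sum_map]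
    simp [List.map_flatten, List.sum_flatten, Function.comp_def]
  simp_rw [hsplit]
  rw [ENNReal.tsum_mul_left, ENNReal.tsum_sigma']
  simp only [pow_sum_map, tsum_list_length_eq, hx]
  simp

end Words

/-! ### Words `e i₀ * (g s₁ * e i₁) * ⋯ * (g sₙ * e iₙ)` -/

section WordVal

variable {R : Type*} [Ring R] {ι X : Type*}

/-- The letter `(s, i)` stands for the product `g s * e i`. -/
def letterVal (e : ι → R) (g : X → R) (u : X × ι) : R := g u.1 * e u.2

/-- The word `(i₀, [(s₁, i₁), …, (sₙ, iₙ)])` stands for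
`e i₀ * (g s₁ * e i₁) * ⋯ * (g sₙ * e iₙ)`. -/
def wordVal (e : ι → R) (g : X → R) (p : ι × List (X × ι)) : R :=
  e p.1 * (p.2.map (letterVal e g)).prod

/-- The degree of a letter. -/
def letterDeg (δ : ι → ℕ) (dg : X → ℕ) (u : X × ι) : ℕ := dg u.1 + δ u.2

/-- The degree of a word. -/
def wordDeg (δ : ι → ℕ) (dg : X → ℕ) (p : ι × List (X × ι)) : ℕ :=
  δ p.1 + (p.2.map (letterDeg δ dg)).sum

theorem mul_wordVal (e : ι → R) (g : X → R) (s : X) (p : ι × List (X × ι)) :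
    g s * wordVal e g p = (((s, p.1) :: p.2).map (letterVal e g)).prod := by
  simp [wordVal, letterVal, mul_assoc]

theorem wordVal_mul_mul_wordVal (e : ι → R) (g : X → R) (s : X) (p q : ι × List (X × ι)) :
    wordVal e g p * g s * wordVal e g q = wordVal e g (p.1, p.2 ++ (s, q.1) :: q.2) := by
  rw [mul_assoc, mul_wordVal, wordVal, wordVal, List.map_append, List.prod_append, mul_assoc]

theorem tsum_letterDeg (δ : ι → ℕ) (dg : X → ℕ) (x : ℝ≥0∞) :
    ∑' u, x ^ letterDeg δ dg u = (∑' i, x ^ δ i) * ∑' s, x ^ dg s := by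
  rw [ENNReal.tsum_prod', ← ENNReal.tsum_mul_left]
  refine tsum_congr fun s => ?_
  rw [← ENNReal.tsum_mul_right]
  exact tsum_congr fun i => by rw [letterDeg, pow_add, mul_comm]

/-- The generating function of all words is `B (1 + BS + (BS)² + ⋯)`. -/
theorem tsum_wordDeg (δ : ι → ℕ) (dg : X → ℕ) (x : ℝ≥0∞) :
    ∑' p, x ^ wordDeg δ dg p =
      (∑' i, x ^ δ i) * ∑' n : ℕ, ((∑' i, x ^ δ i) * ∑' s, x ^ dg s) ^ n := by
  rw [ENNReal.tsum_prod', ← tsum_letterDeg, ← tsum_list, ← ENNReal.tsum_mul_right]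
  refine tsum_congr fun i => ?_
  rw [← ENNReal.tsum_mul_left]
  exact tsum_congr fun l => by rw [wordDeg, pow_add, pow_sum_map]

theorem finite_words_of_degree {δ : ι → ℕ} {dg : X → ℕ} (hpos : ∀ s, 0 < dg s)
    (hδ : ∀ n, {i | δ i = n}.Finite) (hdg : ∀ n, {s | dg s = n}.Finite) (n : ℕ) :
    {p | wordDeg δ dg p = n}.Finite := by
  have hl : ∀ n, {u | letterDeg δ dg u = n}.Finite := fun n => by
    refine ((Set.finite_Iic n).biUnion fun a _ => (Set.finite_Iic n).biUnion fun b _ =>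
      (hdg a).prod (hδ b)).subset ?_
    rintro ⟨s, i⟩ (h : dg s + δ i = n)
    simp only [Set.mem_iUnion, Set.mem_prod, Set.mem_ofPred_eq, Set.mem_Iic]
    exact ⟨dg s, by lia, δ i, by lia, rfl, rfl⟩
  have hL := finite_lists_of_degree (d := letterDeg δ dg)
    (fun u => (hpos u.1).trans_le (Nat.le_add_right _ _)) hl
  refine ((Set.finite_Iic n).biUnion fun a _ => (Set.finite_Iic n).biUnion fun b _ =>
      (hδ a).prod (hL b)).subset ?_
  rintro ⟨i, l⟩ (h : δ i + (l.map (letterDeg δ dg)).sum = n)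
  simp only [Set.mem_iUnion, Set.mem_prod, Set.mem_ofPred_eq, Set.mem_Iic]
  exact ⟨δ i, by lia, _, by lia, rfl, rfl⟩

end WordVal

/-! ### Homogeneous spanning families and the graded quotient `A / I` -/

section Graded

variable {k : Type u} [Field k] {A : Type v} [Ring A] [Algebra k A]
variable (𝒜 : ℕ → Submodule k A) [GradedAlgebra 𝒜]

theorem proj_of_mem {n : ℕ} {a : A} (h : a ∈ 𝒜 n) : GradedAlgebra.proj 𝒜 n a = a := by
  rw [GradedAlgebra.proj_apply, DirectSum.decompose_of_mem_same 𝒜 h]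

theorem proj_of_mem_ne {m n : ℕ} {a : A} (h : a ∈ 𝒜 m) (hmn : m ≠ n) :
    GradedAlgebra.proj 𝒜 n a = 0 := by
  rw [GradedAlgebra.proj_apply, DirectSum.decompose_of_mem_ne 𝒜 h hmn]

theorem proj_mem_span {Ω : Type*} {w : Ω → A} {d : Ω → ℕ} (hw : ∀ ω, w ω ∈ 𝒜 (d ω)) {a : A}
    {s : Set Ω} (ha : a ∈ Submodule.span k (w '' s)) (n : ℕ) :
    GradedAlgebra.proj 𝒜 n a ∈ Submodule.span k (w '' (s ∩ {ω | d ω = n})) := by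
  induction ha using Submodule.span_induction with
  | mem x hx =>
    obtain ⟨ω, hω, rfl⟩ := hx
    by_cases h : d ω = n
    · rw [proj_of_mem 𝒜 (h ▸ hw ω)]
      exact Submodule.subset_span ⟨ω, ⟨hω, h⟩, rfl⟩
    · rw [proj_of_mem_ne 𝒜 (hw ω) h]
      exact Submodule.zero_mem _
  | zero => rw [map_zero]; exact Submodule.zero_mem _
  | add x y _ _ hx hy => rw [map_add]; exact Submodule.add_mem _ hx hy
  | smul c x _ hx => rw [map_smul]; exact Submodule.smul_mem _ c hx

theorem proj_mem_span_range {Ω : Type*} {w : Ω → A} {d : Ω → ℕ} (hw : ∀ ω, w ω ∈ 𝒜 (d ω)) {a : A}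
    (ha : a ∈ Submodule.span k (Set.range w)) (n : ℕ) :
    GradedAlgebra.proj 𝒜 n a ∈ Submodule.span k (w '' {ω | d ω = n}) := by
  rw [← Set.image_univ] at ha
  simpa using proj_mem_span 𝒜 hw ha n

theorem component_eq_span {Ω : Type*} {w : Ω → A} {d : Ω → ℕ} (hw : ∀ ω, w ω ∈ 𝒜 (d ω))
    (h : Submodule.span k (Set.range w) = ⊤) (n : ℕ) :
    𝒜 n = Submodule.span k (w '' {ω | d ω = n}) := by
  refine le_antisymm (fun a ha => ?_) (Submodule.span_le.mpr ?_)
  · rw [← proj_of_mem 𝒜 ha]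
    exact proj_mem_span_range 𝒜 hw (h ▸ Submodule.mem_top) n
  · rintro _ ⟨ω, rfl, rfl⟩
    exact hw ω

theorem span_homogeneous : Submodule.span k (Set.range fun x : Σ i, 𝒜 i => (x.2 : A)) = ⊤ := by
  classical
  refine eq_top_iff.mpr fun a _ => ?_
  rw [← DirectSum.sum_support_decompose 𝒜 a]
  exact Submodule.sum_mem _ fun i _ => Submodule.subset_span ⟨⟨i, _⟩, rfl⟩

variable {S : Set A} {deg : S → ℕ}

theorem mem_span_triples {a : A} (ha : a ∈ TwoSidedIdeal.span S) :
    a ∈ Submodule.span k (Set.range fun ω : (Σ i, 𝒜 i) × S × (Σ i, 𝒜 i) =>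
      (ω.1.2 : A) * ω.2.1 * ω.2.2.2) := by
  rw [TwoSidedIdeal.mem_span_iff_mem_addSubgroup_closure] at ha
  refine (AddSubgroup.closure_le (Submodule.toAddSubgroup (Submodule.span k
    (Set.range fun ω : (Σ i, 𝒜 i) × S × (Σ i, 𝒜 i) => (ω.1.2 : A) * ω.2.1 * ω.2.2.2)))).mpr ?_ ha
  rintro _ ⟨_, ⟨x, -, s, hs, rfl⟩, y, -, rfl⟩
  have hx : x ∈ Submodule.span k (Set.range fun x : Σ i, 𝒜 i => (x.2 : A)) :=
    span_homogeneous 𝒜 ▸ Submodule.mem_top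
  have hy : y ∈ Submodule.span k (Set.range fun x : Σ i, 𝒜 i => (x.2 : A)) :=
    span_homogeneous 𝒜 ▸ Submodule.mem_top
  have := Submodule.mul_mem_mul (Submodule.mul_mem_mul hx (Submodule.subset_span hs)) hy
  rw [Submodule.span_mul_span, Submodule.span_mul_span] at this
  refine Submodule.span_mono ?_ this
  rintro _ ⟨_, ⟨_, ⟨x, rfl⟩, s, hs, rfl⟩, _, ⟨y, rfl⟩, rfl⟩
  exact ⟨⟨x, ⟨s, hs⟩, y⟩, rfl⟩

/-- The homogeneous components of elements of `I` are combinations of products `x * s * y` of the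
same degree. -/
theorem proj_mem_span_triples (hdeg : ∀ s : S, (s : A) ∈ 𝒜 (deg s)) {a : A}
    (ha : a ∈ TwoSidedIdeal.span S) (n : ℕ) :
    GradedAlgebra.proj 𝒜 n a ∈ Submodule.span k ((fun ω : (Σ i, 𝒜 i) × S × (Σ i, 𝒜 i) =>
      (ω.1.2 : A) * ω.2.1 * ω.2.2.2) '' {ω | ω.1.1 + deg ω.2.1 + ω.2.2.1 = n}) :=
  proj_mem_span_range 𝒜 (w := fun ω : (Σ i, 𝒜 i) × S × (Σ i, 𝒜 i) =>
      (ω.1.2 : A) * ω.2.1 * ω.2.2.2) (d := fun ω => ω.1.1 + deg ω.2.1 + ω.2.2.1)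
    (fun ω => SetLike.mul_mem_graded (SetLike.mul_mem_graded ω.1.2.2 (hdeg ω.2.1)) ω.2.2.2.2)
    (mem_span_triples 𝒜 ha) n

theorem smul_mem_twoSidedIdeal (I : TwoSidedIdeal A) (c : k) {a : A} (ha : a ∈ I) : c • a ∈ I := by
  rw [Algebra.smul_def]
  exact I.mul_mem_left _ _ ha

theorem span_le_twoSidedIdeal (I : TwoSidedIdeal A) {T : Set A} (hT : T ⊆ I) {a : A}
    (ha : a ∈ Submodule.span k T) : a ∈ I := by
  induction ha using Submodule.span_induction with
  | mem x hx => exact hT hx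
  | zero => exact I.zero_mem
  | add x y _ _ hx hy => exact I.add_mem hx hy
  | smul c x _ hx => exact smul_mem_twoSidedIdeal I c hx

theorem proj_mem_ideal (hdeg : ∀ s : S, (s : A) ∈ 𝒜 (deg s)) {a : A}
    (ha : a ∈ TwoSidedIdeal.span S) (n : ℕ) :
    GradedAlgebra.proj 𝒜 n a ∈ TwoSidedIdeal.span S := by
  refine span_le_twoSidedIdeal _ ?_ (proj_mem_span_triples 𝒜 hdeg ha n)
  rintro _ ⟨ω, -, rfl⟩
  exact TwoSidedIdeal.mul_mem_right _ _ _
    (TwoSidedIdeal.mul_mem_left _ _ _ (TwoSidedIdeal.subset_span ω.2.1.2))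

variable (k S) in
/-- The projection `A → A / I`. -/
abbrev quotMk : A →ₐ[k] QuotAlg S := RingCon.mkₐ k (TwoSidedIdeal.span S).ringCon

theorem quotMk_eq_zero {a : A} : quotMk k S a = 0 ↔ a ∈ TwoSidedIdeal.span S :=
  RingCon.eq _

theorem quotMk_surjective : Function.Surjective (quotMk k S) :=
  RingCon.mk'_surjective _

/-- As `I` is homogeneous, `A / I` is graded by the images of the components. -/
theorem quotGrading_isInternal (hdeg : ∀ s : S, (s : A) ∈ 𝒜 (deg s)) :
    DirectSum.IsInternal (quotGrading 𝒜 S) := by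
  classical
  constructor
  · refine (injective_iff_map_eq_zero _).mpr fun x hx => ?_
    have hl : ∀ n, ∃ a ∈ 𝒜 n, quotMk k S a = x n := fun n => (x n).2
    choose a ha hax using hl
    have hsum : quotMk k S (∑ n ∈ x.support, a n) = 0 := by
      rw [map_sum, ← hx, DirectSum.coeAddMonoidHom_eq_dfinsuppSum, DFinsupp.sum]
      exact Finset.sum_congr rfl fun n _ => hax n
    ext n
    by_cases hn : n ∈ x.support
    · have h := proj_mem_ideal 𝒜 hdeg (quotMk_eq_zero.mp hsum) n
      rw [map_sum, Finset.sum_eq_single n (fun m _ hm => proj_of_mem_ne 𝒜 (ha m) hm)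
        (fun h => absurd hn h), proj_of_mem 𝒜 (ha n)] at h
      rw [← hax, quotMk_eq_zero.mpr h]
      rfl
    · rw [DFinsupp.notMem_support_iff.mp hn]
      rfl
  · intro b
    obtain ⟨a, rfl⟩ := quotMk_surjective (k := k) b
    rw [← DirectSum.sum_support_decompose 𝒜 a]
    refine ⟨∑ i ∈ (DirectSum.decompose 𝒜 a).support,
      DirectSum.of (fun n => quotGrading 𝒜 S n) i ⟨_, ⟨_, (DirectSum.decompose 𝒜 a i).2, rfl⟩⟩, ?_⟩
    rw [map_sum, map_sum]
    refine Finset.sum_congr rfl fun i _ => ?_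
    rw [DirectSum.coeAddMonoidHom_of]
    rfl

theorem exists_homogeneous_basis (hfin : ∀ n, Module.Finite k (𝒜 n))
    (hdeg : ∀ s : S, (s : A) ∈ 𝒜 (deg s)) :
    ∃ (ι : Type v) (β : Module.Basis ι k (QuotAlg S)) (δ : ι → ℕ),
      (∀ n, quotGrading 𝒜 S n = Submodule.span k (β '' {i | δ i = n})) ∧
      ∀ n, {i | δ i = n}.Finite := by
  have hint := quotGrading_isInternal 𝒜 hdeg
  have hfin' : ∀ n, Module.Finite k (quotGrading 𝒜 S n) := fun n =>
    Module.Finite.map (𝒜 n) (quotMk k S).toLinearMap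
  let b := fun n => Module.Basis.ofVectorSpace k (quotGrading 𝒜 S n)
  refine ⟨_, hint.collectedBasis b, Sigma.fst, fun n => ?_, fun n => ?_⟩
  · have : hint.collectedBasis b '' {i | i.1 = n} =
        (quotGrading 𝒜 S n).subtype '' Set.range (b n) := by
      rw [hint.collectedBasis_coe]
      ext y
      constructor
      · rintro ⟨⟨m, i⟩, rfl, rfl⟩
        exact ⟨_, ⟨i, rfl⟩, rfl⟩
      · rintro ⟨_, ⟨i, rfl⟩, rfl⟩
        exact ⟨⟨n, i⟩, rfl, rfl⟩
    rw [this, Submodule.span_image, (b n).span_eq, Submodule.map_subtype_top]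
  · have := Module.Finite.finite_basis (b n)
    refine (Set.finite_range fun i => (⟨n, i⟩ : Σ n, _)).subset ?_
    rintro ⟨m, i⟩ rfl
    exact ⟨i, rfl⟩

/-! ### Words span `A` -/

variable {ι : Type*} {β : Module.Basis ι k (QuotAlg S)} {δ : ι → ℕ} {σ : ι → A}

theorem wordVal_mem (hσ : ∀ i, σ i ∈ 𝒜 (δ i)) (hdeg : ∀ s : S, (s : A) ∈ 𝒜 (deg s))
    (p : ι × List (S × ι)) : wordVal σ Subtype.val p ∈ 𝒜 (wordDeg δ deg p) := by
  refine SetLike.mul_mem_graded (hσ _) ?_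
  induction p.2 with
  | nil => simpa using SetLike.one_mem_graded 𝒜
  | cons u l ih =>
    simp only [List.map_cons, List.prod_cons, List.sum_cons]
    exact SetLike.mul_mem_graded (SetLike.mul_mem_graded (hdeg _) (hσ _)) ih

/-- Every element of `A` is a combination of the lifts of a basis of `A / I`, up to an element of
`I`; the latter is handled by induction on the degree. -/
theorem span_words_eq_top (hdeg : ∀ s : S, (s : A) ∈ 𝒜 (deg s)) (hpos : ∀ s : S, 0 < deg s)
    (hσ : ∀ i, σ i ∈ 𝒜 (δ i)) (hβ : ∀ i, quotMk k S (σ i) = β i) :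
    Submodule.span k (Set.range (wordVal σ (Subtype.val : S → A))) = ⊤ := by
  suffices h : ∀ n, ∀ a ∈ 𝒜 n, a ∈ Submodule.span k (Set.range (wordVal σ (Subtype.val : S → A)))
    by
      refine eq_top_iff.mpr ((span_homogeneous 𝒜).ge.trans (Submodule.span_le.mpr ?_))
      rintro _ ⟨⟨n, a⟩, rfl⟩
      exact h n a a.2
  intro n
  induction n using Nat.strong_induction_on with
  | _ n ih =>
  intro a ha
  set W := Submodule.span k (Set.range (wordVal σ (Subtype.val : S → A))) with hW
  set y := Finsupp.linearCombination k σ (β.repr (quotMk k S a)) with hy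
  have hyW : y ∈ W := by
    rw [hy, Finsupp.linearCombination_apply, Finsupp.sum]
    exact Submodule.sum_mem _ fun i _ => Submodule.smul_mem _ _
      (Submodule.subset_span ⟨(i, []), by simp [wordVal]⟩)
  have hyI : a - y ∈ TwoSidedIdeal.span S := by
    rw [← quotMk_eq_zero (k := k), map_sub, sub_eq_zero, hy, Finsupp.linearCombination_apply,
      map_finsuppSum]
    simp only [map_smul, hβ]
    rw [← Finsupp.linearCombination_apply, β.linearCombination_repr]
  have hpy : GradedAlgebra.proj 𝒜 n y ∈ W :=
    Submodule.span_mono (Set.image_subset_range _ _)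
      (proj_mem_span_range 𝒜 (wordVal_mem 𝒜 hσ hdeg) hyW n)
  have hpI : GradedAlgebra.proj 𝒜 n (a - y) ∈ W := by
    refine Submodule.span_le.mpr ?_ (proj_mem_span_triples 𝒜 hdeg hyI n)
    rintro _ ⟨⟨⟨i, x⟩, s, ⟨j, z⟩⟩, h, rfl⟩
    replace h : i + deg s + j = n := h
    have hs := hpos s
    have := Submodule.mul_mem_mul (Submodule.mul_mem_mul (ih i (by lia) x x.2)
      (Submodule.mem_span_singleton_self (R := k) (s : A))) (ih j (by lia) z z.2)
    rw [hW, Submodule.span_mul_span, Submodule.span_mul_span] at this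
    refine Submodule.span_mono ?_ this
    rintro _ ⟨_, ⟨_, ⟨p, rfl⟩, _, rfl, rfl⟩, _, ⟨q, rfl⟩, rfl⟩
    exact ⟨_, (wordVal_mul_mul_wordVal σ Subtype.val s p q).symm⟩
  rw [← proj_of_mem 𝒜 ha, ← sub_add_cancel a y, map_add]
  exact W.add_mem hpI hpy

/-- If the words are linearly dependent, then a shortest word `w` of a nontrivial relation is a
combination of other words that are at least as long, and the word `s * w` can be rewritten.  Hence
words without aligned blocks `s * w` suffice to span `A`. -/
theorem exists_blockAvoiding_span [Nonempty S] (hdeg : ∀ s : S, (s : A) ∈ 𝒜 (deg s))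
    (hpos : ∀ s : S, 0 < deg s) (hσ : ∀ i, σ i ∈ 𝒜 (δ i))
    (hspan : Submodule.span k (Set.range (wordVal σ (Subtype.val : S → A))) = ⊤)
    (hdep : ¬ LinearIndependent k (wordVal σ (Subtype.val : S → A))) :
    ∃ v : List (S × ι), ∀ n, 𝒜 n ≤ Submodule.span k
      ((fun b : ι × BlockAvoiding v => wordVal σ (Subtype.val : S → A) (b.1, b.2.toList)) ''
        {b | wordDeg δ deg (b.1, b.2.toList) = n}) := by
  classical
  set W := wordVal σ (Subtype.val : S → A) with hW
  set f := letterVal σ (Subtype.val : S → A) with hf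
  obtain ⟨s⟩ := ‹Nonempty S›
  rw [linearIndependent_iff] at hdep
  push Not at hdep
  obtain ⟨c, hc0, hc⟩ := hdep
  obtain ⟨p₀, hp₀, hmin⟩ := Finset.exists_min_image c.support (fun p => p.2.length)
    (Finsupp.support_nonempty_iff.mpr hc)
  refine ⟨(s, p₀.1) :: p₀.2, ?_⟩
  set v := (s, p₀.1) :: p₀.2 with hvdef
  have hv : (v.map f).prod ∈
      Submodule.span k (Set.range fun l : OtherBlock v => (l.1.1.map f).prod) ⊔
        longSpan k f (v.length + 1) := by
    rw [hvdef, hf, ← mul_wordVal, ← hvdef, ← hf, ← hW]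
    refine (Submodule.smul_mem_iff _ (Finsupp.mem_support_iff.mp hp₀)).mp ?_
    rw [Finsupp.linearCombination_apply, Finsupp.sum, ← Finset.add_sum_erase _ _ hp₀] at hc0
    rw [← mul_smul_comm, eq_neg_of_add_eq_zero_left hc0, mul_neg, Finset.mul_sum]
    refine Submodule.neg_mem _ (Submodule.sum_mem _ fun p hp => ?_)
    rw [Finset.mem_erase] at hp
    rw [mul_smul_comm, hW, mul_wordVal, ← hf]
    refine Submodule.smul_mem _ _ ?_
    have hlen := hmin p hp.2
    rcases hlen.eq_or_lt with h | h
    · refine Submodule.mem_sup_left (Submodule.subset_span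
        ⟨⟨⟨(s, p.1) :: p.2, by simp [hvdef, h]⟩, fun h' => hp.1 ?_⟩, rfl⟩)
      have h'' := congrArg Subtype.val h'
      simp only [hvdef, List.cons.injEq, Prod.mk.injEq, true_and] at h''
      exact Prod.ext h''.1 h''.2
    · exact Submodule.mem_sup_right (Submodule.subset_span
        ⟨(s, p.1) :: p.2, by rw [Set.mem_ofPred_eq]; simpa [hvdef] using h, rfl⟩)
  intro n a ha
  have hlong : ∀ m, Submodule.span k (Set.range σ) * longSpan k f m =
      Submodule.span k (W '' {p | m ≤ p.2.length}) := fun m => by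
    rw [longSpan, Submodule.span_mul_span]
    congr 1
    ext y
    constructor
    · rintro ⟨_, ⟨i, rfl⟩, _, ⟨l, hl, rfl⟩, rfl⟩
      exact ⟨(i, l), hl, rfl⟩
    · rintro ⟨⟨i, l⟩, hl, rfl⟩
      exact ⟨_, ⟨i, rfl⟩, _, ⟨l, hl, rfl⟩, rfl⟩
  have hmem : a ∈ Submodule.span k (Set.range σ) * longSpan k f 0 := by
    rw [hlong]
    simp [hspan]
  have hle := mul_le_mul' (le_refl (Submodule.span k (Set.range σ)))
    (longSpan_le_blockAvoiding (by simp [hvdef]) hv (n + 1))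
  rw [Submodule.mul_sup, hlong (n + 1)] at hle
  obtain ⟨y, hy, z, hz, rfl⟩ := Submodule.mem_sup.mp (hle hmem)
  rw [← proj_of_mem 𝒜 ha, map_add]
  -- words longer than `n` have degree greater than `n`
  have hz0 : GradedAlgebra.proj 𝒜 n z = 0 := by
    have := proj_mem_span 𝒜 (wordVal_mem 𝒜 hσ hdeg) hz n
    rw [← Submodule.mem_bot k, ← Submodule.span_empty]
    convert this
    refine (Set.image_eq_empty.mpr (Set.eq_empty_of_forall_notMem ?_)).symm
    rintro ⟨i, l⟩ ⟨h1, h2⟩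
    have hlen : ∀ l : List (S × ι), l.length ≤ (l.map (letterDeg δ deg)).sum := fun l => by
      induction l with
      | nil => simp
      | cons u l ih => have := hpos u.1; simp [letterDeg]; lia
    have h3 := hlen l
    replace h1 : n + 1 ≤ l.length := h1
    replace h2 : δ i + (l.map (letterDeg δ deg)).sum = n := h2
    lia
  rw [hz0, add_zero]
  refine proj_mem_span_range 𝒜
    (w := fun b : ι × BlockAvoiding v => W (b.1, b.2.toList)) (fun b => wordVal_mem 𝒜 hσ hdeg _) ?_ n
  rw [Submodule.span_mul_span] at hy
  refine Submodule.span_mono ?_ hy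
  rintro _ ⟨_, ⟨i, rfl⟩, _, ⟨b, rfl⟩, rfl⟩
  exact ⟨(i, b), rfl⟩

end Graded

/-! ### Words form a homogeneous basis of the free product `B * k⟨X⟩` -/

section FreeProductBasis

variable {k : Type u} [Field k] {B : Type v} [Ring B] [Algebra k B] {X : Type w}
  {ι : Type*} (β : Module.Basis ι k B)

/-- The operator on `List (X × ι) →₀ B` by which the free generator `s` acts: it sends `β i · l` to
`1 · (s, i) :: l`. -/
noncomputable def genAction (s : X) : Module.End k (List (X × ι) →₀ B) :=
  Finsupp.lsum k fun l => β.constr k fun i => Finsupp.single ((s, i) :: l) 1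

theorem genAction_single (s : X) (l : List (X × ι)) (i : ι) :
    genAction β s (Finsupp.single l (β i)) = Finsupp.single ((s, i) :: l) 1 := by
  simp [genAction]

/-- The action of the two factors of `B * k⟨X⟩` on `List (X × ι) →₀ B`; the algebra `B` acts on the
coefficients. -/
noncomputable def factorAction : {i : Bool} →
    Factor B (FreeAlgebra k X) i →ₐ[k] Module.End k (List (X × ι) →₀ B)
  | false => (Algebra.lsmul k k (List (X × ι) →₀ B)).comp
      (ULift.algEquiv (R := k) (A := B) : ULift.{max u w} B ≃ₐ[k] B).toAlgHom
  | true => (FreeAlgebra.lift k (genAction β)).comp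
      (ULift.algEquiv (R := k) (A := FreeAlgebra k X) :
        ULift.{v} (FreeAlgebra k X) ≃ₐ[k] FreeAlgebra k X).toAlgHom

/-- The action of `B * k⟨X⟩` on `List (X × ι) →₀ B`, in which words act freely. -/
noncomputable def freeProdAction :
    FreeProd k B (FreeAlgebra k X) →ₐ[k] Module.End k (List (X × ι) →₀ B) :=
  LinearAlgebra.FreeProduct.lift k (Factor B (FreeAlgebra k X)) (factorAction β)

theorem freeProdAction_inl (b : B) (m : List (X × ι) →₀ B) :
    freeProdAction β (inl k B (FreeAlgebra k X) b) m = b • m := by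
  have h := DFunLike.congr_fun (LinearAlgebra.FreeProduct.lift_comp_ι k
    (Factor B (FreeAlgebra k X)) (maps := factorAction β) (i := false)) (ULift.up b)
  exact DFunLike.congr_fun h m

theorem freeProdAction_inr (s : X) (m : List (X × ι) →₀ B) :
    freeProdAction β (inr k B (FreeAlgebra k X) (FreeAlgebra.ι k s)) m = genAction β s m := by
  have h := DFunLike.congr_fun (LinearAlgebra.FreeProduct.lift_comp_ι k
    (Factor B (FreeAlgebra k X)) (maps := factorAction β) (i := true))
    (ULift.up (FreeAlgebra.ι k s))
  refine (DFunLike.congr_fun h m).trans ?_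
  exact DFunLike.congr_fun (FreeAlgebra.lift_ι_apply (genAction β) s) m

theorem freeProdAction_wordVal (p : ι × List (X × ι)) :
    freeProdAction β (wordVal (fun i => inl k B (FreeAlgebra k X) (β i))
      (fun s => inr k B (FreeAlgebra k X) (FreeAlgebra.ι k s)) p) (Finsupp.single [] 1) =
        Finsupp.single p.2 (β p.1) := by
  obtain ⟨i, l⟩ := p
  rw [wordVal, map_mul, Module.End.mul_apply, freeProdAction_inl]
  suffices h : freeProdAction β ((l.map (letterVal (fun i => inl k B (FreeAlgebra k X) (β i))
      (fun s => inr k B (FreeAlgebra k X) (FreeAlgebra.ι k s)))).prod) (Finsupp.single [] 1) =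
        Finsupp.single l 1 by
    rw [h, Finsupp.smul_single, smul_eq_mul, mul_one]
  induction l with
  | nil => simp
  | cons u l ih =>
    rw [List.map_cons, List.prod_cons, map_mul, Module.End.mul_apply, ih, letterVal, map_mul,
      Module.End.mul_apply, freeProdAction_inl, Finsupp.smul_single, smul_eq_mul, mul_one,
      freeProdAction_inr, genAction_single]

/-- Applied to the vector `1 · []`, the words yield the vectors `β i · l`, which form a basis. -/
theorem linearIndependent_words :
    LinearIndependent k (wordVal (fun i => inl k B (FreeAlgebra k X) (β i))
      (fun s : X => inr k B (FreeAlgebra k X) (FreeAlgebra.ι k s))) := by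
  let ev : FreeProd k B (FreeAlgebra k X) →ₗ[k] (List (X × ι) →₀ B) :=
    (LinearMap.applyₗ (Finsupp.single [] 1)).comp (freeProdAction (X := X) β).toLinearMap
  refine LinearIndependent.of_comp ev ?_
  have h := (Finsupp.basis fun _ : List (X × ι) => β).linearIndependent
  have h' := h.comp (fun p : ι × List (X × ι) => (⟨p.2, p.1⟩ : Σ _ : List (X × ι), ι))
    (fun p q hpq => by
      cases p; cases q; simp only [Sigma.mk.injEq, heq_eq_eq] at hpq; simp [hpq])
  convert h' using 1
  funext p
  exact (freeProdAction_wordVal β p).trans (by simp)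

variable {β} {ℬ : ℕ → Submodule k B} {δ : ι → ℕ} {deg : X → ℕ}

theorem IsHomogProd.of_word (hβ : ∀ i, β i ∈ ℬ (δ i)) (p : ι × List (X × ι)) :
    IsHomogProd ℬ (freeAlgebraGrading k deg) (wordDeg δ deg p)
      (wordVal (fun i => inl k B (FreeAlgebra k X) (β i))
        (fun s => inr k B (FreeAlgebra k X) (FreeAlgebra.ι k s)) p) := by
  obtain ⟨i, l⟩ := p
  refine .inl_mul (hβ i) ?_
  induction l with
  | nil => exact .one
  | cons u l ih =>
    simp only [List.map_cons, List.prod_cons, List.sum_cons, letterVal, letterDeg]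
    rw [mul_assoc, add_assoc]
    exact .inr_mul (Submodule.subset_span ⟨[u.1], by simp, by simp⟩) (.inl_mul (hβ _) ih)

/-- The words of degree `n` contain `1` and are stable, up to linear combinations, under left
multiplication by homogeneous elements of `B` and by free generators. -/
theorem freeProdGrading_eq_span (hβ : ∀ n, ℬ n = Submodule.span k (β '' {i | δ i = n}))
    (hone : (1 : B) ∈ ℬ 0) (hmul : ∀ m n, ∀ b ∈ ℬ m, ∀ c ∈ ℬ n, b * c ∈ ℬ (m + n)) (n : ℕ) :
    freeProdGrading ℬ (freeAlgebraGrading k deg) n =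
      Submodule.span k (wordVal (fun i => inl k B (FreeAlgebra k X) (β i))
        (fun s => inr k B (FreeAlgebra k X) (FreeAlgebra.ι k s)) ''
          {p | wordDeg δ deg p = n}) := by
  have hβ' : ∀ i, β i ∈ ℬ (δ i) := fun i => by
    rw [hβ]; exact Submodule.subset_span ⟨i, rfl, rfl⟩
  set w := wordVal (fun i => inl k B (FreeAlgebra k X) (β i))
    (fun s => inr k B (FreeAlgebra k X) (FreeAlgebra.ι k s)) with hw
  let W := fun n => Submodule.span k (w '' {p | wordDeg δ deg p = n})
  -- left multiplication by a homogeneous element of `B` maps words to combinations of words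
  have hinl : ∀ m n, ∀ b ∈ ℬ m, ∀ y ∈ W n, inl k B (FreeAlgebra k X) b * y ∈ W (m + n) := by
    intro m n b hb y hy
    induction hy using Submodule.span_induction with
    | mem y hy =>
      obtain ⟨⟨i, l⟩, hp, rfl⟩ := hy
      replace hp : δ i + (l.map (letterDeg δ deg)).sum = n := hp
      have h := hmul m (δ i) b hb _ (hβ' i)
      rw [hβ] at h
      have key : ∀ c ∈ Submodule.span k (β '' {j | δ j = m + δ i}),
          inl k B (FreeAlgebra k X) c * (l.map (letterVal (fun i => inl k B (FreeAlgebra k X) (β i))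
            (fun s => inr k B (FreeAlgebra k X) (FreeAlgebra.ι k s)))).prod ∈ W (m + n) := by
        intro c hc
        induction hc using Submodule.span_induction with
        | mem c hc =>
          obtain ⟨j, hj, rfl⟩ := hc
          replace hj : δ j = m + δ i := hj
          refine Submodule.subset_span ⟨(j, l), ?_, rfl⟩
          change δ j + (l.map (letterDeg δ deg)).sum = m + n
          lia
        | zero => rw [map_zero, zero_mul]; exact Submodule.zero_mem _
        | add c d _ _ hc hd => rw [map_add, add_mul]; exact Submodule.add_mem _ hc hd
        | smul a c _ hc => rw [map_smul, smul_mul_assoc]; exact Submodule.smul_mem _ a hc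
      have h2 := key _ h
      rwa [map_mul, mul_assoc] at h2
    | zero => rw [mul_zero]; exact Submodule.zero_mem _
    | add c d _ _ hc hd => rw [mul_add]; exact Submodule.add_mem _ hc hd
    | smul a c _ hc => rw [mul_smul_comm]; exact Submodule.smul_mem _ a hc
  have hone' : (1 : FreeProd k B (FreeAlgebra k X)) ∈ W 0 := by
    have key : ∀ c ∈ Submodule.span k (β '' {j | δ j = 0}),
        inl k B (FreeAlgebra k X) c ∈ W 0 := by
      intro c hc
      induction hc using Submodule.span_induction with
      | mem c hc =>
        obtain ⟨j, hj, rfl⟩ := hc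
        exact Submodule.subset_span ⟨(j, []), hj, by simp [hw, wordVal]⟩
      | zero => rw [map_zero]; exact Submodule.zero_mem _
      | add c d _ _ hc hd => rw [map_add]; exact Submodule.add_mem _ hc hd
      | smul a c _ hc => rw [map_smul]; exact Submodule.smul_mem _ a hc
    simpa using key 1 (hβ 0 ▸ hone)
  have hgen : ∀ n s, ∀ y ∈ W n,
      inr k B (FreeAlgebra k X) (FreeAlgebra.ι k s) * y ∈ W (deg s + n) := by
    intro n s y hy
    induction hy using Submodule.span_induction with
    | mem y hy =>
      obtain ⟨⟨i, l⟩, hp, rfl⟩ := hy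
      replace hp : δ i + (l.map (letterDeg δ deg)).sum = n := hp
      -- a word has to start with an element of `B`
      rw [hw, mul_wordVal (fun i => inl k B (FreeAlgebra k X) (β i))
        (fun s => inr k B (FreeAlgebra k X) (FreeAlgebra.ι k s)), ← one_mul (List.prod _),
        ← map_one (inl k B (FreeAlgebra k X))]
      have h1 := hone
      rw [hβ] at h1
      have key : ∀ c ∈ Submodule.span k (β '' {j | δ j = 0}),
          inl k B (FreeAlgebra k X) c * (((s, i) :: l).map
            (letterVal (fun i => inl k B (FreeAlgebra k X) (β i))
            (fun s => inr k B (FreeAlgebra k X) (FreeAlgebra.ι k s)))).prod ∈ W (deg s + n) := by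
        intro c hc
        induction hc using Submodule.span_induction with
        | mem c hc =>
          obtain ⟨j, hj, rfl⟩ := hc
          replace hj : δ j = 0 := hj
          refine Submodule.subset_span ⟨(j, (s, i) :: l), ?_, rfl⟩
          change δ j + (letterDeg δ deg (s, i) + (l.map (letterDeg δ deg)).sum) = deg s + n
          rw [letterDeg]
          lia
        | zero => rw [map_zero, zero_mul]; exact Submodule.zero_mem _
        | add c d _ _ hc hd => rw [map_add, add_mul]; exact Submodule.add_mem _ hc hd
        | smul a c _ hc => rw [map_smul, smul_mul_assoc]; exact Submodule.smul_mem _ a hc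
      exact key 1 h1
    | zero => rw [mul_zero]; exact Submodule.zero_mem _
    | add c d _ _ hc hd => rw [mul_add]; exact Submodule.add_mem _ hc hd
    | smul a c _ hc => rw [mul_smul_comm]; exact Submodule.smul_mem _ a hc
  refine le_antisymm (Submodule.span_le.mpr fun y hy => ?_) (Submodule.span_le.mpr ?_)
  · change y ∈ W n
    induction hy with
    | one => exact hone'
    | inl_mul hb _ ih => exact hinl _ _ _ hb _ ih
    | @inr_mul m n z y hz _ ih =>
      induction hz using Submodule.span_induction with
      | mem z hz =>
        obtain ⟨l, rfl, rfl⟩ := hz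
        induction l with
        | nil => simpa using ih
        | cons s l ihl =>
          simp only [List.map_cons, List.prod_cons, List.sum_cons]
          rw [map_mul, mul_assoc, add_assoc]
          exact hgen _ s _ ihl
      | zero => rw [map_zero, zero_mul]; exact Submodule.zero_mem _
      | add c d _ _ hc hd => rw [map_add, add_mul]; exact Submodule.add_mem _ hc hd
      | smul a c _ hc => rw [map_smul, smul_mul_assoc]; exact Submodule.smul_mem _ a hc
  · rintro _ ⟨p, rfl, rfl⟩
    exact Submodule.subset_span (IsHomogProd.of_word hβ' p)

end FreeProductBasis

/-! ### The Hilbert series of a finitely generated algebra diverges at its radius -/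

section Finite

/-- A convolution inequality over windows of bounded length `d` forces the series to diverge at its
radius of convergence: if the terms `a n * r ^ n` tend to `0`, they decay geometrically. -/
theorem lt_seriesRadius_of_convolution_le {a : ℕ → ℕ} {d : ℕ} (hd : 0 < d)
    (ha : ∀ m N, d ≤ m → m ≤ N → a N ≤ ∑ j ∈ Finset.Ioc (m - d) m, a j * a (N - j))
    {r : NNReal} (hr : 0 < r) (h : evalSeries (PowerSeries.mk a) r ≠ ∞) :
    (r : ℝ≥0∞) < seriesRadius (PowerSeries.mk a) := by
  set b : ℕ → ℝ := fun n => a n * (r : ℝ) ^ n with hb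
  have hr' : (0 : ℝ) < r := hr
  have hb0 : ∀ n, 0 ≤ b n := fun n => by positivity
  have hsum : Summable b := by
    rw [evalSeries_eq_coe, ENNReal.tsum_coe_ne_top_iff_summable_coe] at h
    simpa [hb] using h
  have hdR : (0 : ℝ) < d := by exact_mod_cast hd
  have hconv : ∀ m N, d ≤ m → m ≤ N → b N ≤ ∑ j ∈ Finset.Ioc (m - d) m, b j * b (N - j) := by
    intro m N hm hN
    have h1 : (a N : ℝ) ≤ ∑ j ∈ Finset.Ioc (m - d) m, (a j : ℝ) * a (N - j) := by
      exact_mod_cast ha m N hm hN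
    calc b N ≤ (∑ j ∈ Finset.Ioc (m - d) m, (a j : ℝ) * a (N - j)) * (r : ℝ) ^ N :=
          mul_le_mul_of_nonneg_right h1 (by positivity)
      _ = _ := by
          rw [Finset.sum_mul]
          refine Finset.sum_congr rfl fun j hj => ?_
          have hjN : N = j + (N - j) := by have := (Finset.mem_Ioc.mp hj).2; lia
          rw [hb]
          nth_rewrite 2 [hjN]
          rw [pow_add]
          ring
  -- in a window of length `d` far out, the terms `b j` add up to at most `1 / 2`
  obtain ⟨M, hM⟩ := Filter.eventually_atTop.mp
    (hsum.tendsto_atTop_zero.eventually (ge_mem_nhds (show (0 : ℝ) < 1 / (2 * d) by positivity)))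
  set m := M + d with hm
  -- by Bernoulli's inequality, this `ρ < 1` satisfies `ρ ^ m ≥ 1 / 2`
  have hmR : (1 : ℝ) ≤ m := by exact_mod_cast (by lia : 1 ≤ m)
  set ρ : ℝ := 1 + -(1 / (2 * m)) with hρ
  have hinv : 1 / (2 * (m : ℝ)) ≤ 1 / 2 := by
    apply one_div_le_one_div_of_le <;> linarith
  have hinv0 : 0 < 1 / (2 * (m : ℝ)) := by positivity
  have hρ0 : 0 < ρ := by rw [hρ]; linarith
  have hρ1 : ρ < 1 := by rw [hρ]; linarith
  have hρm : 1 / 2 ≤ ρ ^ m := by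
    have := one_add_mul_le_pow (a := -(1 / (2 * (m : ℝ)))) (by linarith) m
    have h2 : 1 + (m : ℝ) * -(1 / (2 * m)) = 1 / 2 := by
      field_simp; norm_num
    rw [h2] at this
    exact this
  set K := (∑ n ∈ Finset.range m, b n) / ρ ^ m with hK
  have hK0 : 0 ≤ K := div_nonneg (Finset.sum_nonneg fun n _ => hb0 n) (by positivity)
  have hdecay : ∀ N, b N ≤ K * ρ ^ N := by
    intro N
    induction N using Nat.strong_induction_on with
    | _ N ih =>
    rcases lt_or_ge N m with hN | hN
    · calc b N ≤ ∑ n ∈ Finset.range m, b n :=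
            Finset.single_le_sum (fun n _ => hb0 n) (Finset.mem_range.mpr hN)
        _ = K * ρ ^ m := by rw [hK, div_mul_cancel₀]; positivity
        _ ≤ K * ρ ^ N := mul_le_mul_of_nonneg_left
            (pow_le_pow_of_le_one hρ0.le hρ1.le hN.le) hK0
    · calc b N ≤ ∑ j ∈ Finset.Ioc (m - d) m, b j * b (N - j) := hconv m N (by lia) hN
        _ ≤ ∑ j ∈ Finset.Ioc (m - d) m, 1 / (2 * d) * (K * ρ ^ (N - m)) := by
            refine Finset.sum_le_sum fun j hj => ?_
            rw [Finset.mem_Ioc] at hj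
            refine mul_le_mul (hM j (by lia)) ((ih (N - j) (by lia)).trans ?_) (hb0 _)
              (by positivity)
            exact mul_le_mul_of_nonneg_left
              (pow_le_pow_of_le_one hρ0.le hρ1.le (by lia)) hK0
        _ = 1 / 2 * (K * ρ ^ (N - m)) := by
            rw [Finset.sum_const, Nat.card_Ioc, show m - (m - d) = d by lia, nsmul_eq_mul]
            field_simp
        _ ≤ ρ ^ m * (K * ρ ^ (N - m)) :=
            mul_le_mul_of_nonneg_right hρm (by positivity)
        _ = K * ρ ^ N := by
            rw [mul_left_comm, ← pow_add, Nat.add_sub_cancel' hN]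
  have hlt : r < r / ρ.toNNReal := by
    rw [← NNReal.coe_lt_coe, NNReal.coe_div, Real.coe_toNNReal ρ hρ0.le, lt_div_iff₀ hρ0]
    exact mul_lt_of_lt_one_right hr' hρ1
  refine (ENNReal.coe_lt_coe.mpr hlt).trans_le (le_seriesRadius_of_bound K fun n => ?_)
  rw [PowerSeries.coeff_mk, NNReal.coe_div, Real.coe_toNNReal ρ hρ0.le, div_pow, ← mul_div_assoc,
    div_le_iff₀ (by positivity)]
  exact hdecay n

variable {k : Type u} [Field k] {A : Type v} [Ring A] [Algebra k A]

theorem finrank_mul_le_mul (P Q : Submodule k A) [Module.Finite k P] [Module.Finite k Q] :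
    Module.finrank k (P * Q : Submodule k A) ≤ Module.finrank k P * Module.finrank k Q := by
  rw [← Submodule.mulMap_range, ← Module.finrank_tensorProduct]
  exact LinearMap.finrank_range_le _

theorem finrank_finset_sum_le {J : Type*} (s : Finset J) (P : J → Submodule k A)
    (hP : ∀ j, Module.Finite k (P j)) :
    Module.Finite k (∑ j ∈ s, P j : Submodule k A) ∧
      Module.finrank k (∑ j ∈ s, P j : Submodule k A) ≤ ∑ j ∈ s, Module.finrank k (P j) := by
  classical
  induction s using Finset.induction_on with
  | empty =>
    rw [Finset.sum_empty, Submodule.zero_eq_bot]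
    exact ⟨inferInstance, by simp⟩
  | insert j s hj ih =>
    obtain ⟨h1, h2⟩ := ih
    have := hP j
    rw [Finset.sum_insert hj, Finset.sum_insert hj, Submodule.add_eq_sup]
    exact ⟨inferInstance, (Submodule.finrank_add_le_finrank_add_finrank _ _).trans
      (Nat.add_le_add_left h2 _)⟩

variable (𝒜 : ℕ → Submodule k A) [GradedAlgebra 𝒜]

/-- A finitely generated graded algebra is generated by elements of bounded degree. -/
theorem exists_adjoin_eq_top (hfg : Algebra.FiniteType k A) :
    ∃ d, 0 < d ∧ Algebra.adjoin k {a | ∃ i ≤ d, a ∈ 𝒜 i} = ⊤ := by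
  classical
  obtain ⟨s, hs⟩ := hfg
  refine ⟨(s.sup fun a => (DirectSum.decompose 𝒜 a).support.sup id) + 1, Nat.succ_pos _, ?_⟩
  refine eq_top_iff.mpr (hs.ge.trans (Algebra.adjoin_le fun a ha => ?_))
  rw [SetLike.mem_coe, ← DirectSum.sum_support_decompose 𝒜 a]
  refine Subalgebra.sum_mem _ fun i hi => Algebra.subset_adjoin ⟨i, ?_, SetLike.coe_mem _⟩
  have h1 : i ≤ (DirectSum.decompose 𝒜 a).support.sup id := Finset.le_sup (f := id) hi
  have h2 := Finset.le_sup (f := fun a => (DirectSum.decompose 𝒜 a).support.sup id) ha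
  exact (h1.trans h2).trans (Nat.le_succ _)

/-- A product of generators of degree at most `d` splits as a prefix, whose degree is in a given
window of length `d`, and a suffix. -/
theorem exists_split_of_mem_closure {d : ℕ} (hd : 0 < d) {z : A}
    (hz : z ∈ Submonoid.closure {a | ∃ i ≤ d, a ∈ 𝒜 i}) :
    ∃ N, z ∈ 𝒜 N ∧ ∀ m ≤ N, ∃ j ≤ m, m < j + d ∧ ∃ p ∈ 𝒜 j, ∃ q ∈ 𝒜 (N - j), p * q = z := by
  induction hz using Submonoid.closure_induction_left with
  | one =>
    refine ⟨0, SetLike.one_mem_graded 𝒜, fun m hm => ⟨0, Nat.zero_le _, by lia, 1,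
      SetLike.one_mem_graded 𝒜, 1, SetLike.one_mem_graded 𝒜, one_mul 1⟩⟩
  | mul_left g hg z _ ih =>
    obtain ⟨i, hi, hg⟩ := hg
    obtain ⟨N, hz, h⟩ := ih
    have hgz := SetLike.mul_mem_graded hg hz
    refine ⟨i + N, hgz, fun m hm => ?_⟩
    rcases lt_or_ge m i with hmi | hmi
    · exact ⟨0, Nat.zero_le _, by lia, 1, SetLike.one_mem_graded 𝒜, g * z, hgz, one_mul _⟩
    · obtain ⟨j, hj, hjd, p, hp, q, hq, rfl⟩ := h (m - i) (by lia)
      refine ⟨i + j, by lia, by lia, g * p, SetLike.mul_mem_graded hg hp, q, ?_, mul_assoc _ _ _⟩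
      rwa [show i + N - (i + j) = N - j by lia]

theorem finrank_le_convolution (hfin : ∀ n, Module.Finite k (𝒜 n)) {d : ℕ} (hd : 0 < d)
    (hgen : Algebra.adjoin k {a | ∃ i ≤ d, a ∈ 𝒜 i} = ⊤) {m N : ℕ} (hm : d ≤ m) (hN : m ≤ N) :
    Module.finrank k (𝒜 N) ≤ ∑ j ∈ Finset.Ioc (m - d) m,
      Module.finrank k (𝒜 j) * Module.finrank k (𝒜 (N - j)) := by
  have hle : 𝒜 N ≤ ∑ j ∈ Finset.Ioc (m - d) m, 𝒜 j * 𝒜 (N - j) := by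
    intro a ha
    choose D hD hsplit using fun z : Submonoid.closure {a | ∃ i ≤ d, a ∈ 𝒜 i} =>
      exists_split_of_mem_closure 𝒜 hd z.2
    have hmem : a ∈ Submodule.span k
        (Set.range fun z : Submonoid.closure {a | ∃ i ≤ d, a ∈ 𝒜 i} => (z : A)) := by
      have h := Algebra.adjoin_eq_span k {a | ∃ i ≤ d, a ∈ 𝒜 i}
      rw [hgen] at h
      rw [Subtype.range_coe_subtype]
      exact h.le (Algebra.mem_top (R := k))
    have hp := proj_mem_span_range 𝒜 hD hmem N
    rw [proj_of_mem 𝒜 ha] at hp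
    refine Submodule.span_le.mpr ?_ hp
    rintro _ ⟨z, rfl, rfl⟩
    obtain ⟨j, hj, hjd, p, hp, q, hq, hpq⟩ := hsplit z m hN
    rw [← hpq]
    have hjm : j ∈ Finset.Ioc (m - d) m := Finset.mem_Ioc.mpr ⟨by lia, hj⟩
    exact Finset.single_le_sum (f := fun j => 𝒜 j * 𝒜 (D z - j)) (fun _ _ => bot_le) hjm
      (Submodule.mul_mem_mul hp hq)
  have hfin' : ∀ j, Module.Finite k (𝒜 j * 𝒜 (N - j) : Submodule k A) := fun j => by
    rw [← Submodule.mulMap_range]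
    infer_instance
  obtain ⟨h1, h2⟩ := finrank_finset_sum_le (Finset.Ioc (m - d) m) _ hfin'
  exact (Submodule.finrank_mono hle).trans (h2.trans (Finset.sum_le_sum fun j _ =>
    finrank_mul_le_mul _ _))

theorem evalHilbert_radius_eq_top (hfin : ∀ n, Module.Finite k (𝒜 n)) (hr : 0 < radius 𝒜)
    (hfg : Algebra.FiniteType k A) {n : ℕ} (hn : 0 < n) {a : A} (ha : a ∈ 𝒜 n) (ha0 : a ≠ 0) :
    evalHilbert 𝒜 (radius 𝒜) = ∞ := by
  by_contra h
  obtain ⟨d, hd, hgen⟩ := exists_adjoin_eq_top 𝒜 hfg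
  rcases eq_or_ne (radius 𝒜) ∞ with htop | htop
  · rw [htop, evalHilbert, evalSeries] at h
    refine ENNReal.ne_top_of_tsum_ne_top h n ?_
    have hne : Module.finrank k (𝒜 n) ≠ 0 := fun h0 => by
      rw [Submodule.finrank_eq_zero] at h0
      rw [h0] at ha
      exact ha0 ((Submodule.mem_bot k).mp ha)
    rw [ENNReal.top_pow hn.ne', hilbertSeries, PowerSeries.coeff_mk,
      ENNReal.mul_top (by exact_mod_cast hne)]
  · have hcoe := ENNReal.coe_toNNReal htop
    have := lt_seriesRadius_of_convolution_le hd
      (fun m N hm hN => finrank_le_convolution 𝒜 hfin hd hgen hm hN)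
      (r := (radius 𝒜).toNNReal) (ENNReal.toNNReal_pos hr.ne' htop) (by rw [hcoe]; exact h)
    rw [hcoe] at this
    exact lt_irrefl _ this

end Finite

/-! ### Consequences of minimality -/

section Minimal

variable {k : Type u} [Field k] {A : Type v} [Ring A] [Algebra k A] {S : Set A}

theorem MinimallyGenerates.linearIndependent (hmin : MinimallyGenerates S) :
    LinearIndependent k (Subtype.val : S → A) := by
  rw [linearIndependent_iff_notMem_span]
  intro s hs
  have hss : S \ {(s : A)} ⊂ S := Set.sdiff_singleton_ssubset.mpr s.2
  refine hmin _ hss (le_antisymm (TwoSidedIdeal.span_mono hss.subset)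
    (TwoSidedIdeal.span_le.mpr fun t ht => ?_))
  by_cases hts : t = s
  · rw [hts]
    refine span_le_twoSidedIdeal _ ?_ hs
    rintro _ ⟨x, hx, rfl⟩
    exact TwoSidedIdeal.subset_span ⟨x.2, fun h => hx.2 (Subtype.ext h)⟩
  · exact TwoSidedIdeal.subset_span ⟨ht, hts⟩

theorem MinimallyGenerates.finite_of_degree (hmin : MinimallyGenerates S)
    {𝒜 : ℕ → Submodule k A} (hfin : ∀ n, Module.Finite k (𝒜 n)) {deg : S → ℕ}
    (hdeg : ∀ s : S, (s : A) ∈ 𝒜 (deg s)) (n : ℕ) : {s | deg s = n}.Finite := by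
  have := hfin n
  let f : {s // deg s = n} → 𝒜 n := fun s => ⟨s.1, by
    have h := hdeg s.1; rwa [s.2] at h⟩
  have hf : LinearIndependent k f := by
    refine LinearIndependent.of_comp (𝒜 n).subtype ?_
    exact (hmin.linearIndependent (k := k)).comp Subtype.val Subtype.val_injective
  exact hf.finite

end Minimal

end GradedGrowth

/-! ### The inequality and the characterizations of equality -/

theorem mainTheorem1 {k : Type u} [Field k] {A : Type v} [Ring A] [Algebra k A]
    (𝒜 : ℕ → Submodule k A) [GradedAlgebra 𝒜]
    (hconn : IsConnectedGraded 𝒜) (hr : 0 < radius 𝒜)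
    -- `A` is finitely generated or, more generally, `A(t) → ∞` for `t → r(A)`
    (hA : Algebra.FiniteType k A ∨ evalHilbert 𝒜 (radius 𝒜) = ∞)
    (S : Set A) (hS : S.Nonempty)
    (deg : S → ℕ) (hdeg : ∀ s : S, (s : A) ∈ 𝒜 (deg s)) (hpos : ∀ s : S, 0 < deg s)
    (hmin : MinimallyGenerates S) :
    1 ≤ evalHilbert (quotGrading 𝒜 S) (radius 𝒜) * evalGen deg (radius 𝒜) ∧
    List.TFAE
      [evalHilbert (quotGrading 𝒜 S) (radius 𝒜) * evalGen deg (radius 𝒜) = 1,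
       radius 𝒜 = radius (extGrading 𝒜 S deg),
       StronglyFree 𝒜 S deg] ∧
    ∀ t l : ℕ, S.encard = t → (∀ s : S, deg s = l) →
      (t : ℝ≥0∞) ≥ (evalHilbert (quotGrading 𝒜 S) (radius 𝒜))⁻¹ * (radius 𝒜 ^ l)⁻¹ ∧
      ((t : ℝ≥0∞) = (evalHilbert (quotGrading 𝒜 S) (radius 𝒜))⁻¹ * (radius 𝒜 ^ l)⁻¹ ↔
        StronglyFree 𝒜 S deg) := by
  have hfin := hconn.finite
  obtain ⟨s₀, hs₀⟩ := hS
  have : Nonempty S := ⟨⟨s₀, hs₀⟩⟩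
  have hlin := hmin.linearIndependent (k := k)
  have hAtop : evalHilbert 𝒜 (radius 𝒜) = ∞ := hA.elim
    (fun hfg => evalHilbert_radius_eq_top 𝒜 hfin hr hfg (hpos ⟨s₀, hs₀⟩) (hdeg ⟨s₀, hs₀⟩)
      (hlin.ne_zero _)) id
  obtain ⟨ι, β, δ, hβ, hδ⟩ := exists_homogeneous_basis 𝒜 hfin hdeg
  have hβmem : ∀ i, β i ∈ quotGrading 𝒜 S (δ i) := fun i => by
    rw [hβ]; exact Submodule.subset_span ⟨i, rfl, rfl⟩
  choose σ hσ hσβ using hβmem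
  have hB : ∀ x, evalHilbert (quotGrading 𝒜 S) x = ∑' i, x ^ δ i :=
    evalHilbert_eq_tsum δ β.linearIndependent hβ hδ
  have hspan := span_words_eq_top 𝒜 hdeg hpos hσ hσβ
  have hAcomp := component_eq_span 𝒜 (wordVal_mem 𝒜 hσ hdeg) hspan
  have hCcomp := freeProdGrading_eq_span (X := S) (deg := deg) hβ
    ⟨1, SetLike.one_mem_graded 𝒜, map_one (quotMk k S)⟩ (by
      rintro m n _ ⟨a, ha, rfl⟩ _ ⟨b, hb, rfl⟩
      exact ⟨a * b, SetLike.mul_mem_graded ha hb, map_mul (quotMk k S) _ _⟩)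
  have hCind := linearIndependent_words (X := S) β
  have hCval : ∀ x, evalHilbert (extGrading 𝒜 S deg) x =
      evalHilbert (quotGrading 𝒜 S) x *
        (1 - evalHilbert (quotGrading 𝒜 S) x * evalGen deg x)⁻¹ := fun x => by
    rw [hB, evalGen, ← ENNReal.tsum_geometric, ← tsum_wordDeg]
    exact evalHilbert_eq_tsum _ hCind hCcomp
      (finite_words_of_degree hpos hδ (hmin.finite_of_degree hfin hdeg)) x
  have hAval : ∀ x, evalHilbert 𝒜 x ≤ evalHilbert (quotGrading 𝒜 S) x *
        (1 - evalHilbert (quotGrading 𝒜 S) x * evalGen deg x)⁻¹ := fun x => by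
    rw [hB, evalGen, ← ENNReal.tsum_geometric, ← tsum_wordDeg]
    exact evalHilbert_le_tsum _ _ (fun n => (hAcomp n).le) x
  set r := radius 𝒜 with hrdef
  have hS0 : evalGen deg r ≠ 0 := fun h =>
    (pow_ne_zero _ hr.ne') (ENNReal.tsum_eq_zero.mp h ⟨s₀, hs₀⟩)
  have hBtop : evalHilbert (quotGrading 𝒜 S) r * evalGen deg r ≠ ∞ →
      evalHilbert (quotGrading 𝒜 S) r ≠ ∞ := fun h h' => h (by rw [h', ENNReal.top_mul hS0])
  have hge : 1 ≤ evalHilbert (quotGrading 𝒜 S) r * evalGen deg r := by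
    by_contra hlt
    push Not at hlt
    refine ENNReal.mul_ne_top (hBtop hlt.ne_top)
      (ENNReal.inv_ne_top.mpr (tsub_pos_of_lt hlt).ne') (top_unique ?_)
    exact hAtop.ge.trans (hAval r)
  have htfae : List.TFAE
      [evalHilbert (quotGrading 𝒜 S) r * evalGen deg r = 1,
       r = radius (extGrading 𝒜 S deg), StronglyFree 𝒜 S deg] := by
    tfae_have 1 → 3 := by
      intro h1
      have hAind : LinearIndependent k (wordVal σ (Subtype.val : S → A)) := by
        by_contra hdep
        obtain ⟨v, hv⟩ := exists_blockAvoiding_span 𝒜 hdeg hpos hσ hspan hdep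
        have hle := evalHilbert_le_tsum _ _ hv r
        rw [hAtop, top_le_iff, ENNReal.tsum_prod'] at hle
        simp only [wordDeg, pow_add, ENNReal.tsum_mul_left, ENNReal.tsum_mul_right] at hle
        rw [tsum_blockAvoiding _ _ _ (by rw [tsum_letterDeg, ← hB]; exact h1), ← hB,
          ENNReal.tsum_geometric] at hle
        refine ENNReal.mul_ne_top (hBtop (by simp [h1])) (ENNReal.mul_ne_top
          (ENNReal.inv_ne_top.mpr (tsub_pos_of_lt ?_).ne') (ENNReal.natCast_ne_top _)) hle
        exact ENNReal.sub_lt_self ENNReal.one_ne_top one_ne_zero (pow_ne_zero _ hr.ne')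
      rw [StronglyFree, hilbertSeries_eq_card _ hAind hAcomp]
      exact hilbertSeries_eq_card _ hCind hCcomp
    tfae_have 3 → 2 := fun h => by
      rw [hrdef, radius, radius, show hilbertSeries (extGrading 𝒜 S deg) = hilbertSeries 𝒜 from h]
    tfae_have 2 → 1 := by
      intro h2
      refine le_antisymm ?_ hge
      rw [hB, evalGen, ← tsum_letterDeg]
      refine tsum_pow_le_of_forall_lt _ hr fun x hx => ?_
      rw [tsum_letterDeg, ← hB]
      by_contra hlt
      push Not at hlt
      have hC := evalSeries_ne_top_of_lt (f := hilbertSeries (extGrading 𝒜 S deg)) (h2 ▸ hx)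
      refine hC ((hCval x).trans ?_)
      rw [evalGen, tsub_eq_zero_of_le hlt.le, ENNReal.inv_zero, ENNReal.mul_top]
      exact left_ne_zero_of_mul (zero_lt_one.trans hlt).ne'
    tfae_finish
  refine ⟨hge, htfae, fun t l ht hl => ?_⟩
  have hgen : evalGen deg r = t * r ^ l := by
    have hcard : ENat.card S = t := ht
    simp [evalGen, hl, ENNReal.tsum_const, hcard]
  have hiff : evalHilbert (quotGrading 𝒜 S) r * evalGen deg r = 1 ↔ StronglyFree 𝒜 S deg :=
    htfae.out 0 2
  rw [← hiff]
  rw [hgen] at hge hS0 hBtop ⊢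
  have hl0 : l ≠ 0 := by rw [← hl ⟨s₀, hs₀⟩]; exact (hpos _).ne'
  have ht0 := left_ne_zero_of_mul hS0
  set b := evalHilbert (quotGrading 𝒜 S) r
  have hb0 : b ≠ 0 := left_ne_zero_of_mul (zero_lt_one.trans_le hge).ne'
  -- if `r = ∞` or `B(r) = ∞`, then the right-hand side is zero and the product is infinite
  by_cases hinf : b = ∞ ∨ r = ∞
  · have h0 : b⁻¹ * (r ^ l)⁻¹ = 0 := by
      rcases hinf with h | h
      · simp [h]
      · simp [h, ENNReal.top_pow hl0]
    have h1 : b * (t * r ^ l) = ∞ := by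
      rcases hinf with h | h
      · rw [h, ENNReal.top_mul hS0]
      · rw [h, ENNReal.top_pow hl0, ENNReal.mul_top ht0, ENNReal.mul_top hb0]
    rw [h0, h1]
    exact ⟨zero_le, by simp [ht0]⟩
  · push Not at hinf
    have hrl0 : r ^ l ≠ 0 := pow_ne_zero _ hr.ne'
    have hrl : r ^ l ≠ ∞ := ENNReal.pow_ne_top hinf.2
    rw [← ENNReal.mul_inv (.inl hb0) (.inl hinf.1), mul_left_comm]
    have hc0 : b * r ^ l ≠ 0 := mul_ne_zero hb0 hrl0
    have hc : b * r ^ l ≠ ∞ := ENNReal.mul_ne_top hinf.1 hrl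
    rw [mul_left_comm] at hge
    refine ⟨?_, ?_⟩
    · rw [ge_iff_le, ← one_div]
      exact ENNReal.div_le_of_le_mul hge
    · rw [← one_div, ENNReal.eq_div_iff hc0 hc, mul_comm]
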